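/- Consider an M/M/1 system with arrival rate $\lambda>0$, service rate $\mu>0$, cost $c>0$ per unit of time for each customer in the system, and reward $r>0$ upon each service completion. It is observed in rounds, separated by independent events, each an arrival with probability $\lambda/(\lambda+\mu)$ and a service with probability $\mu/(\lambda+\mu)$ (fictitious if the system is idle); a customer in the system pays the expected cost $c/(\lambda+\mu)$ in each round. Let $n^*=n^*(\lambda,\mu,c,r)$ be a socially optimal threshold, i.e. a value of $n\in\mathbb N$ that maximizes the long-run average welfare (rewards minus costs of all customers, per unit of time) of the policy that admits customers as long as there are at most $n$ of them in the system (in case of ties, $n^*$ may be any maximizer). For $n\ge1$ let $(y_k)_{k\ge0}$ be the chain with $y_0=n$ and $y_k=\min(y_{k-1}+1,n)$ if the $k$-th event is an arrival, $y_k=\max(y_{k-1}-1,0)$ if it is a service, and let $$D_n=r\,\theta_n-\frac{c}{\lambda+\mu}\,T_n,$$ where $\theta_n$ is the probability that $y_1,y_2,\dots$ reaches $0$ before it reaches $n$, and $T_n$ is the expected number of rounds until it reaches $0$ or $n$. A (work-conserving) queuing regime consists of a set of states $\mathcal X=\biguplus_{n\ge0}\mathcal X_n$, where $\mathcal X_n$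 is the set of states with $n$ customers, occupying positions $1,\dots,n$ (position $1$ is served) and $\mathcal X_0$ is a singleton; of maps giving, for $x\in\mathcal X_n$, the new state $\alpha(x)\in\mathcal X_{n+1}$ after an arrival, $\xi(x)\in\mathcal X_{n-1}$ after a service ($n\ge1$), and $\rho_i(x)\in\mathcal X_{n-1}$ after the customer at position $i\in\{1,\dots,n\}$ reneges, with $\rho_i(\rho_j(x))=\rho_{j-1}(\rho_i(x))$ for $i<j\leq n$; and of the position $\pi(x)\in\{1,\dots,n+1\}$ at which an arriving customer is placed. These events do not change the relative order of the other customers. The game starts at a state $x$. At the beginning of each round all customers simultaneously decide whether to stay or to renege, then the round is spent by the remaining customers, and the next event (arrival or service) ends it. A customer's payoff is $r$ times the probability that she is eventually served minus $c/(\lambda+\mu)$ times the expected number of rounds that she spends in the system. The strategies of the customer and of her opponents (the other present and future customers) may depend on the history, and those of the opponents may be randomized, independently of the events. Staying is called a weakly (strictly) dominant action for a customer at position $i$ of state $x$ if she has a strategy that stays now and that, against every strategy of the opponents, gives a payoff at least as large as (strictly larger than) that of every strategy that reneges now. **Lemma.** Under every regime, for every state $x$ and every customer whose position in the queue at $x$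 is at most $n^*(\lambda,\mu,c,r)$, staying is a weakly dominant action. If $D_{n^*(\lambda,\mu,c,r)}>0$, then it is strictly dominant. -/

import Mathlib

open MeasureTheory Filter

/-- Parameters of the M/M/1 system: arrival rate, service rate, waiting cost per unit of time and
reward upon service completion. -/
structure QueueParams where
  lam : ℝ
  mu : ℝ
  c : ℝ
  r : ℝ
  lam_pos : 0 < lam
  mu_pos : 0 < mu
  c_pos : 0 < c
  r_pos : 0 < r

namespace QueueParams

/-- Probability that the next event is an arrival. -/
noncomputable def arrivalProb (P : QueueParams) : ℝ := P.lam / (P.lam + P.mu)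

/-- Probability that the next event is a service. -/
noncomputable def serviceProb (P : QueueParams) : ℝ := P.mu / (P.lam + P.mu)

/-- Expected waiting cost of one customer during one round; the duration of a round is exponential
with rate `lam + mu`. -/
noncomputable def roundCost (P : QueueParams) : ℝ := P.c / (P.lam + P.mu)

/-- Law of a single event: `true` is an arrival and `false` is a service. -/
noncomputable def eventLaw (P : QueueParams) : Measure Bool :=
  ENNReal.ofReal P.arrivalProb • Measure.dirac true +
    ENNReal.ofReal P.serviceProb • Measure.dirac false

instance (P : QueueParams) : IsProbabilityMeasure P.eventLaw := by
  constructor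
  have hl := P.lam_pos
  have hm := P.mu_pos
  have h1 : (0 : ℝ) ≤ P.arrivalProb := by unfold arrivalProb; positivity
  have h2 : (0 : ℝ) ≤ P.serviceProb := by unfold serviceProb; positivity
  have h3 : P.arrivalProb + P.serviceProb = 1 := by
    unfold arrivalProb serviceProb
    field_simp
  simp [eventLaw, ← ENNReal.ofReal_add h1 h2, h3]

/-- Law of the sequence of successive events, which are independent and identically distributed. -/
noncomputable def eventsLaw (P : QueueParams) : Measure (ℕ → Bool) :=
  Measure.infinitePi fun _ => P.eventLaw

instance (P : QueueParams) : IsProbabilityMeasure P.eventsLaw := by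
  unfold eventsLaw; infer_instance

end QueueParams

/-- Number of customers under the threshold-`n` policy, starting with `a` customers: an arrival is
admitted only if this leaves at most `n` customers, and a service at an idle system is fictitious.
The event `ω k` separates round `k` from round `k + 1`. -/
def thresholdQueue (n a : ℕ) (ω : ℕ → Bool) : ℕ → ℕ
  | 0 => a
  | k + 1 =>
    if ω k = true then min (thresholdQueue n a ω k + 1) n else thresholdQueue n a ω k - 1

namespace QueueParams

/-- Welfare generated in round `k`, on the path `ω`, by the threshold-`n` policy started at the idle
system: the reward if round `k` ends with the service of a customer, minus the waiting cost of the
customers who are in the system during round `k`. -/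
noncomputable def roundWelfare (P : QueueParams) (n : ℕ) (ω : ℕ → Bool) (k : ℕ) : ℝ :=
  (if ω k = false ∧ 0 < thresholdQueue n 0 ω k then P.r else 0) -
    P.roundCost * thresholdQueue n 0 ω k

/-- Expected welfare during the first `K` rounds divided by their expected physical duration
`K / (lam + mu)`. -/
noncomputable def averageWelfare (P : QueueParams) (n K : ℕ) : ℝ :=
  (∫ ω, ∑ k ∈ Finset.range K, P.roundWelfare n ω k ∂P.eventsLaw) / (K / (P.lam + P.mu))

/-- Long-run (undiscounted) average welfare per unit of time of the threshold-`n` policy. -/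
noncomputable def longRunWelfare (P : QueueParams) (n : ℕ) : ℝ :=
  liminf (fun K => P.averageWelfare n K) atTop

/-- `N` is a socially optimal threshold. -/
def IsSociallyOptimalThreshold (P : QueueParams) (N : ℕ) : Prop :=
  ∀ n : ℕ, P.longRunWelfare n ≤ P.longRunWelfare N

/-- Probability that the chain `thresholdQueue n n` reaches `0` before it returns to `n`. -/
noncomputable def theta (P : QueueParams) (n : ℕ) : ℝ :=
  (P.eventsLaw {ω | ∃ k, 1 ≤ k ∧ thresholdQueue n n ω k = 0 ∧
    ∀ j, 1 ≤ j → j < k → thresholdQueue n n ω j ≠ n}).toReal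

/-- Number of rounds until the chain `thresholdQueue n n` reaches either `0` or `n`; it is `⊤` if
this never happens. -/
noncomputable def blockLength (n : ℕ) (ω : ℕ → Bool) : ENNReal :=
  ⨅ k : ℕ, ⨅ _ : 1 ≤ k ∧ (thresholdQueue n n ω k = 0 ∨ thresholdQueue n n ω k = n), (k : ENNReal)

/-- Expected number of rounds until the chain `thresholdQueue n n` reaches either `0` or `n`. -/
noncomputable def expectedBlockLength (P : QueueParams) (n : ℕ) : ℝ :=
  (∫⁻ ω, blockLength n ω ∂P.eventsLaw).toReal

/-- The quantity `D n = r * θ n - c / (lam + mu) * T n`. -/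
noncomputable def D (P : QueueParams) (n : ℕ) : ℝ :=
  P.r * P.theta n - P.roundCost * P.expectedBlockLength n

end QueueParams

/-- A work-conserving queuing regime with set of states `X`. The states with `n` customers are
those with `size x = n`. Positions are numbered from `1`, the customer at position `1` being served.
The values of `serve` at the idle state, and of `renege i` at states with fewer than `i` customers
or for `i = 0`, are irrelevant. -/
structure QueuingRegime (X : Type*) where
  size : X → ℕ
  idle : X
  size_eq_zero_iff : ∀ x, size x = 0 ↔ x = idle
  /-- new state after an arrival -/
  arrive : X → X
  size_arrive : ∀ x, size (arrive x) = size x + 1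
  /-- new state after a service completion -/
  serve : X → X
  size_serve : ∀ x, 1 ≤ size x → size (serve x) = size x - 1
  /-- new state after the customer at the given position reneges -/
  renege : ℕ → X → X
  size_renege : ∀ i x, 1 ≤ i → i ≤ size x → size (renege i x) = size x - 1
  /-- position at which an arriving customer is placed -/
  position : X → ℕ
  one_le_position : ∀ x, 1 ≤ position x
  position_le : ∀ x, position x ≤ size x + 1
  renege_renege : ∀ i j x, 1 ≤ i → i < j → j ≤ size x →
    renege i (renege j x) = renege (j - 1) (renege i x)

/-- What has happened so far, the latest round first: for each past round, the set of positions of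
the opponents who reneged at its beginning and the event (`true` for an arrival, `false` for a
service) that ended it. Together with the initial state and the initial position of the customer
under consideration, it determines the current state and the customer's current position. -/
abbrev QueueHistory := List (Finset ℕ × Bool)

/-- A (pure, history-dependent) strategy of the customer under consideration: `true` means that she
stays and `false` that she reneges. -/
abbrev CustomerStrategy := QueueHistory → Bool

/-- A joint (pure, history-dependent) strategy of all the opponents, present and future: the
positions at which they renege. -/
abbrev OpponentStrategy := QueueHistory → Finset ℕ

/-- Status of the customer under consideration at the time of a decision: still in the system, at
state `x`, at position `i`, after history `h`; or served; or gone without service. -/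
inductive CustomerStatus (X : Type*) where
  | present (x : X) (i : ℕ) (h : QueueHistory)
  | served
  | gone

namespace QueuingRegime

variable {X : Type*} (R : QueuingRegime X)

/-- New state after the simultaneous reneging of the customers at positions `i₁ < ⋯ < iₖ`, namely
`renege i₁ (⋯ (renege iₖ x))`. -/
def renegeSet (I : Finset ℕ) (x : X) : X := I.sort.foldr R.renege x

/-- The positions that are actually vacated when the opponents of the customer at position `i`
choose `I` at state `x`: those that hold an opponent. -/
def opponentPositions (I : Finset ℕ) (x : X) (i : ℕ) : Finset ℕ :=
  I.filter fun j => 1 ≤ j ∧ j ≤ R.size x ∧ j ≠ i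

/-- Status at the next decision of a customer at position `i` of state `x` who stays, when the
opponents at positions `I` renege and then the event `e` takes place. -/
def afterStay (x : X) (i : ℕ) (h : QueueHistory) (I : Finset ℕ) (e : Bool) : CustomerStatus X :=
  let y := R.renegeSet I x
  let j := i - (I.filter (· < i)).card
  if e = true then
    .present (R.arrive y) (if R.position y ≤ j then j + 1 else j) ((I, e) :: h)
  else if j = 1 then .served
  else .present (R.serve y) (j - 1) ((I, e) :: h)

/-- Status, at each decision time, of the customer who starts at position `i` of state `x` and uses
the strategy `s`, when the opponents use `τ` and the successive events are `ω`. -/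
def play (x : X) (i : ℕ) (s : CustomerStrategy) (τ : OpponentStrategy) (ω : ℕ → Bool) :
    ℕ → CustomerStatus X
  | 0 => .present x i []
  | k + 1 =>
    match play x i s τ ω k with
    | .present x' i' h =>
      if s h = true then R.afterStay x' i' h (R.opponentPositions (τ h) x' i') (ω k) else .gone
    | .served => .served
    | .gone => .gone

/-- The customer spends round `k` in the system. -/
def StaysInRound (x : X) (i : ℕ) (s : CustomerStrategy) (τ : OpponentStrategy) (ω : ℕ → Bool)
    (k : ℕ) : Prop :=
  ∃ x' i' h, R.play x i s τ ω k = .present x' i' h ∧ s h = true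

open Classical in
/-- Number of rounds that the customer spends in the system. -/
noncomputable def roundsInSystem (x : X) (i : ℕ) (s : CustomerStrategy) (τ : OpponentStrategy)
    (ω : ℕ → Bool) : ENNReal :=
  ∑' k : ℕ, if R.StaysInRound x i s τ ω k then 1 else 0

/-- Expected payoff of the customer who starts at position `i` of state `x` and uses `s`, when the
opponents use the randomized strategy `τ`: the randomization device `Z`, with law `ν`, is
independent of the events. It is `⊥` if the expected time in the system is infinite. -/
noncomputable def payoff (P : QueueParams) (x : X) (i : ℕ) (s : CustomerStrategy)
    {Z : Type} [MeasurableSpace Z] (ν : Measure Z) (τ : Z → OpponentStrategy) : EReal :=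
  ((ENNReal.ofReal P.r *
      (ν.prod P.eventsLaw) {z | ∃ k, R.play x i s (τ z.1) z.2 k = .served} : ENNReal) : EReal) -
    ((ENNReal.ofReal P.roundCost *
      ∫⁻ z, R.roundsInSystem x i s (τ z.1) z.2 ∂(ν.prod P.eventsLaw) : ENNReal) : EReal)

/-- Staying is a weakly dominant action for the customer at position `i` of state `x`: some strategy
that stays now is, against all strategies of the opponents, at least as good as every strategy that
reneges now. -/
def StayingWeaklyDominant (P : QueueParams) (x : X) (i : ℕ) : Prop :=
  ∃ s : CustomerStrategy, s [] = true ∧ ∀ s' : CustomerStrategy, s' [] = false →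
    ∀ (Z : Type) [MeasurableSpace Z] (ν : Measure Z) [IsProbabilityMeasure ν]
      (τ : Z → OpponentStrategy), (∀ h I, MeasurableSet {z | τ z h = I}) →
      R.payoff P x i s' ν τ ≤ R.payoff P x i s ν τ

/-- Staying is a strictly dominant action for the customer at position `i` of state `x`: some
strategy that stays now is, against all strategies of the opponents, strictly better than every
strategy that reneges now. -/
def StayingStrictlyDominant (P : QueueParams) (x : X) (i : ℕ) : Prop :=
  ∃ s : CustomerStrategy, s [] = true ∧ ∀ s' : CustomerStrategy, s' [] = false →
    ∀ (Z : Type) [MeasurableSpace Z] (ν : Measure Z) [IsProbabilityMeasure ν]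
      (τ : Z → OpponentStrategy), (∀ h I, MeasurableSet {z | τ z h = I}) →
      R.payoff P x i s' ν τ < R.payoff P x i s ν τ

end QueuingRegime

/-! The customer uses a walk that starts at `i` and moves up at arrivals and down at services. Under
any regime it bounds her position from above, since opponents ahead of her who renege only help her
and an arrival pushes her back by at most one place. `patientStrategy` stays until this walk exceeds
`N`; its payoff is at least `r` times the probability that the walk reaches `0` before `N + 1`,
minus the expected cost of waiting for either (`play_patientStrategy`, `le_payoff_patientStrategy`).

This gambler's-ruin payoff comes from a potential `φ` that gains `roundCost` per round in
expectation, with `φ 0 = r` and `φ (N + 1) = 0`: the payoff is then at least `φ i`. One takes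
`criticalReward (N - u)`, which has the right drift, plus the multiple of the harmonic function
`geomSum (N + 1 - u)` that corrects the value at `0`. As `φ` is decreasing, `φ i ≥ φ N = (r -
criticalReward N) / geomSum (N + 1)` (`surplus_le_payoff_patientStrategy`). Reneging now pays `0`.

It remains to compare `r` with `criticalReward N`. Threshold `N` beats `N - 1` only if
`criticalReward N ≤ r` (`IsSociallyOptimalThreshold.criticalReward_le`, from the stationary welfare
of the threshold policies). The same potential along a block from `N` gives `criticalReward N *
theta N ≤ roundCost * expectedBlockLength N`, so `D N > 0` forces strict inequality
(`criticalReward_lt_of_D_pos`). -/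

/-! ### Chains driven by independent events -/

/-- The chain on `ℕ` driven by the successive events. -/
def eventChain (step : ℕ → Bool → ℕ) (a : ℕ) (ω : ℕ → Bool) : ℕ → ℕ
  | 0 => a
  | k + 1 => step (eventChain step a ω k) (ω k)

theorem eventChain_congr (step : ℕ → Bool → ℕ) (a : ℕ) {ω ω' : ℕ → Bool} (k : ℕ)
    (h : ∀ j < k, ω j = ω' j) : eventChain step a ω k = eventChain step a ω' k := by
  induction k with
  | zero => rfl
  | succ k ih =>
    simp only [eventChain]
    rw [ih fun j hj => h j (by omega), h k (by omega)]

theorem measurable_eventChain (step : ℕ → Bool → ℕ) (a k : ℕ) :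
    Measurable fun ω => eventChain step a ω k := by
  induction k with
  | zero => exact measurable_const
  | succ k ih =>
    exact (measurable_of_countable fun p : ℕ × Bool => step p.1 p.2).comp
      (ih.prodMk (measurable_pi_apply k))

/-- The chain as a function of the first `k` events. -/
theorem eventChain_eq_comp_restrict (step : ℕ → Bool → ℕ) (a k : ℕ) :
    ∃ F : (Finset.range k → Bool) → ℕ,
      ∀ ω : ℕ → Bool, eventChain step a ω k = F fun j => ω j := by
  refine ⟨fun v => eventChain step a
    (fun j => if hj : j ∈ Finset.range k then v ⟨j, hj⟩ else false) k, fun ω => ?_⟩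
  refine eventChain_congr step a k fun j hj => ?_
  simp [hj]

namespace QueueParams

variable (P : QueueParams)

theorem arrivalProb_pos : 0 < P.arrivalProb :=
  div_pos P.lam_pos (add_pos P.lam_pos P.mu_pos)

theorem serviceProb_pos : 0 < P.serviceProb :=
  div_pos P.mu_pos (add_pos P.lam_pos P.mu_pos)

theorem roundCost_pos : 0 < P.roundCost :=
  div_pos P.c_pos (add_pos P.lam_pos P.mu_pos)

theorem arrivalProb_add_serviceProb : P.arrivalProb + P.serviceProb = 1 := by
  have := add_pos P.lam_pos P.mu_pos
  unfold arrivalProb serviceProb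
  field_simp

/-- No bound on `φ` is needed: the state at time `k` is a function of `k` binary events, hence takes
finitely many values. -/
theorem integrable_eventChain (step : ℕ → Bool → ℕ) (a k : ℕ) (φ : ℕ → ℝ) :
    Integrable (fun ω => φ (eventChain step a ω k)) P.eventsLaw := by
  obtain ⟨F, hF⟩ := eventChain_eq_comp_restrict step a k
  have hm : Measurable fun (ω : ℕ → Bool) (j : Finset.range k) => ω j := by fun_prop
  have : IsFiniteMeasure (P.eventsLaw.map fun (ω : ℕ → Bool) (j : Finset.range k) => ω j) :=
    inferInstance
  have h := (integrable_map_measure (μ := P.eventsLaw) (g := fun v => φ (F v))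
    (measurable_of_countable _).aestronglyMeasurable hm.aemeasurable).1 Integrable.of_finite
  refine h.congr (ae_of_all _ fun ω => ?_)
  simp [hF]

theorem measureReal_eventLaw_true : P.eventLaw.real {true} = P.arrivalProb := by
  simp [eventLaw, measureReal_def, P.arrivalProb_pos.le]

theorem measureReal_eventLaw_false : P.eventLaw.real {false} = P.serviceProb := by
  simp [eventLaw, measureReal_def, P.serviceProb_pos.le]

theorem integral_event (k : ℕ) (g : Bool → ℝ) :
    ∫ ω, g (ω k) ∂P.eventsLaw = P.arrivalProb * g true + P.serviceProb * g false := by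
  have hmp := measurePreserving_eval_infinitePi (fun _ : ℕ => P.eventLaw) k
  have h := integral_map (μ := P.eventsLaw) (f := g) hmp.measurable.aemeasurable
    (measurable_of_countable g).aestronglyMeasurable
  have hmap : P.eventsLaw.map (Function.eval k) = P.eventLaw := hmp.map_eq
  rw [hmap] at h
  simp only [Function.eval] at h
  rw [← h, integral_fintype Integrable.of_finite]
  simp [measureReal_eventLaw_true, measureReal_eventLaw_false]

theorem indepFun_eventChain (step : ℕ → Bool → ℕ) (a k : ℕ) :
    ProbabilityTheory.IndepFun (fun ω => eventChain step a ω k) (fun ω => ω k) P.eventsLaw := by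
  obtain ⟨F, hF⟩ := eventChain_eq_comp_restrict step a k
  have h := ProbabilityTheory.iIndepFun_infinitePi (P := fun _ : ℕ => P.eventLaw)
    (X := fun _ b => b) fun _ => measurable_id
  have h2 := (h.indepFun_finset (Finset.range k) {k} (by simp)
    fun j => measurable_pi_apply j).comp (measurable_of_countable F)
    (measurable_pi_apply (⟨k, by simp⟩ : ({k} : Finset ℕ)))
  convert h2 using 1
  · funext ω
    exact hF ω
  · rfl
  · rfl

/-- Conditioning on the past: the next event is independent of the current state. -/
theorem integral_eventChain_event (step : ℕ → Bool → ℕ) (a k : ℕ) (Φ : ℕ → Bool → ℝ) :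
    ∫ ω, Φ (eventChain step a ω k) (ω k) ∂P.eventsLaw =
      ∫ ω, (P.arrivalProb * Φ (eventChain step a ω k) true +
        P.serviceProb * Φ (eventChain step a ω k) false) ∂P.eventsLaw := by
  -- Independence treats products; since an event has two values, a general `Φ` is a sum of two
  -- products with indicators.
  have key : ∀ (φ : ℕ → ℝ) (g : Bool → ℝ),
      Integrable (fun ω => φ (eventChain step a ω k) * g (ω k)) P.eventsLaw ∧
      ∫ ω, φ (eventChain step a ω k) * g (ω k) ∂P.eventsLaw =
        (∫ ω, φ (eventChain step a ω k) ∂P.eventsLaw) *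
          (P.arrivalProb * g true + P.serviceProb * g false) := by
    intro φ g
    have hind := (P.indepFun_eventChain step a k).comp
      (measurable_of_countable φ) (measurable_of_countable g)
    have hi := P.integrable_eventChain step a k φ
    have hg : Integrable (fun ω : ℕ → Bool => g (ω k)) P.eventsLaw :=
      ((measurePreserving_eval_infinitePi (fun _ : ℕ => P.eventLaw) k).integrable_comp
        (measurable_of_countable g).aestronglyMeasurable).2 Integrable.of_finite
    refine ⟨hind.integrable_mul hi hg, ?_⟩
    rw [← P.integral_event k g]
    exact hind.integral_fun_mul_eq_mul_integral hi.aestronglyMeasurable hg.aestronglyMeasurable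
  obtain ⟨i1, e1⟩ := key (fun u => Φ u true) fun b => if b = true then 1 else 0
  obtain ⟨i2, e2⟩ := key (fun u => Φ u false) fun b => if b = true then 0 else 1
  have hsplit : ∀ ω : ℕ → Bool, Φ (eventChain step a ω k) (ω k) =
      Φ (eventChain step a ω k) true * (if ω k = true then 1 else 0) +
      Φ (eventChain step a ω k) false * (if ω k = true then 0 else 1) := by
    intro ω
    cases ω k <;> simp
  simp_rw [hsplit]
  rw [integral_add i1 i2, e1, e2, integral_add
    ((P.integrable_eventChain step a k fun u => Φ u true).const_mul _)
    ((P.integrable_eventChain step a k fun u => Φ u false).const_mul _),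
    integral_const_mul, integral_const_mul]
  simp [mul_comm]

/-- If the potential `φ` has drift `γ` along the chain, then its expectation grows by the
accumulated expectation of `γ`. -/
theorem integral_potential_eventChain (step : ℕ → Bool → ℕ) (a : ℕ) (φ γ : ℕ → ℝ)
    (h : ∀ ω k, P.arrivalProb * φ (step (eventChain step a ω k) true) +
      P.serviceProb * φ (step (eventChain step a ω k) false) =
      φ (eventChain step a ω k) + γ (eventChain step a ω k)) (K : ℕ) :
    ∫ ω, φ (eventChain step a ω K) ∂P.eventsLaw =
      φ a + ∑ k ∈ Finset.range K, ∫ ω, γ (eventChain step a ω k) ∂P.eventsLaw := by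
  induction K with
  | zero => simp [eventChain]
  | succ K ih =>
    rw [Finset.sum_range_succ, ← add_assoc, ← ih,
      ← integral_add (P.integrable_eventChain step a K φ) (P.integrable_eventChain step a K γ)]
    simp only [eventChain]
    rw [P.integral_eventChain_event step a K fun u b => φ (step u b)]
    simp_rw [h]

/-! ### Harmonic function and cost potential of the walk -/

/-- `1 + ρ + ⋯ + ρ ^ (m - 1)`, where `ρ = lam / mu`. -/
noncomputable def geomSum (m : ℕ) : ℝ := ∑ j ∈ Finset.range m, (P.lam / P.mu) ^ j

theorem geomSum_succ (m : ℕ) : P.geomSum (m + 1) = 1 + P.lam / P.mu * P.geomSum m := by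
  unfold geomSum
  rw [Finset.sum_range_succ', Finset.mul_sum, add_comm]
  simp [pow_succ, mul_comm]

theorem geomSum_succ' (m : ℕ) :
    P.geomSum (m + 1) = P.geomSum m + (P.lam / P.mu) ^ m := by
  unfold geomSum
  rw [Finset.sum_range_succ]

@[simp] theorem geomSum_zero : P.geomSum 0 = 0 := by simp [geomSum]

theorem load_pos : 0 < P.lam / P.mu := div_pos P.lam_pos P.mu_pos

theorem geomSum_mono : Monotone P.geomSum := by
  refine monotone_nat_of_le_succ fun m => ?_
  rw [geomSum_succ']
  have := pow_pos P.load_pos m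
  linarith

theorem geomSum_nonneg (m : ℕ) : 0 ≤ P.geomSum m := by
  simpa using P.geomSum_mono (Nat.zero_le m)

theorem geomSum_succ_pos (m : ℕ) : 0 < P.geomSum (m + 1) := by
  rw [geomSum_succ]
  have := mul_nonneg P.load_pos.le (P.geomSum_nonneg m)
  linarith

/-- The smallest reward for which threshold `m` is at least as good as threshold `m - 1`. -/
noncomputable def criticalReward (m : ℕ) : ℝ :=
  P.c / P.mu * ∑ l ∈ Finset.range m, P.geomSum (l + 1)

@[simp] theorem criticalReward_zero : P.criticalReward 0 = 0 := by simp [criticalReward]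

theorem criticalReward_succ (m : ℕ) :
    P.criticalReward (m + 1) = P.criticalReward m + P.c / P.mu * P.geomSum (m + 1) := by
  unfold criticalReward
  rw [Finset.sum_range_succ, mul_add]

theorem criticalReward_mono : Monotone P.criticalReward := by
  refine monotone_nat_of_le_succ fun m => ?_
  rw [criticalReward_succ]
  have := mul_nonneg (div_pos P.c_pos P.mu_pos).le (P.geomSum_succ_pos m).le
  linarith

theorem criticalReward_nonneg (m : ℕ) : 0 ≤ P.criticalReward m := by
  simpa using P.criticalReward_mono (Nat.zero_le m)

/-- Here the argument is the distance to an upper barrier, which an arrival shortens and a service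
lengthens. -/
theorem geomSum_harmonic (m : ℕ) :
    P.arrivalProb * P.geomSum m + P.serviceProb * P.geomSum (m + 2) = P.geomSum (m + 1) := by
  rw [P.geomSum_succ (m + 1), P.geomSum_succ m]
  have h1 := P.lam_pos
  have h2 := P.mu_pos
  have h3 := add_pos h1 h2
  unfold arrivalProb serviceProb
  field_simp
  ring

/-- In the same reading, each round raises this potential by the cost of a round, so its growth
measures accumulated waiting costs. -/
theorem criticalReward_drift (m : ℕ) :
    P.arrivalProb * P.criticalReward m + P.serviceProb * P.criticalReward (m + 2) =
      P.criticalReward (m + 1) + P.roundCost := by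
  rw [P.criticalReward_succ (m + 1), P.criticalReward_succ m, P.geomSum_succ (m + 1),
    P.geomSum_succ m]
  have h1 := P.lam_pos
  have h2 := P.mu_pos
  have h3 := add_pos h1 h2
  unfold arrivalProb serviceProb roundCost
  field_simp
  ring

/-- The drift identity at distance `0`, where an arrival leads to absorption at potential `0`. -/
theorem serviceProb_mul_criticalReward_one :
    P.serviceProb * P.criticalReward 1 = P.roundCost := by
  rw [P.criticalReward_succ 0, P.geomSum_succ 0]
  have h1 := P.lam_pos
  have h2 := P.mu_pos
  have h3 := add_pos h1 h2
  unfold serviceProb roundCost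
  simp
  field_simp

end QueueParams

/-! ### Long-run welfare of the threshold policies -/

/-- One step of the threshold-`n` policy. -/
def thresholdStep (n u : ℕ) (b : Bool) : ℕ := if b = true then min (u + 1) n else u - 1

theorem thresholdQueue_eq_eventChain (n a : ℕ) (ω : ℕ → Bool) (k : ℕ) :
    thresholdQueue n a ω k = eventChain (thresholdStep n) a ω k := by
  induction k with
  | zero => rfl
  | succ k ih => simp only [thresholdQueue, eventChain, thresholdStep, ih]

theorem eventChain_thresholdStep_le (n : ℕ) (ω : ℕ → Bool) (k : ℕ) :
    eventChain (thresholdStep n) 0 ω k ≤ n := by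
  induction k with
  | zero => exact Nat.zero_le n
  | succ k ih =>
    simp only [eventChain, thresholdStep]
    split_ifs <;> omega

namespace QueueParams

variable (P : QueueParams)

/-- Expected welfare of a round with `u` customers. -/
noncomputable def meanRoundWelfare (u : ℕ) : ℝ :=
  P.serviceProb * (if 0 < u then P.r else 0) - P.roundCost * u

/-- Welfare of a round, weighted by the unnormalized stationary distribution. -/
noncomputable def weightedWelfare (n : ℕ) : ℝ :=
  ∑ l ∈ Finset.range (n + 1), (P.lam / P.mu) ^ l * P.meanRoundWelfare l

/-- Stationary expected welfare of a round under the threshold-`n` policy. -/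
noncomputable def stationaryWelfare (n : ℕ) : ℝ := P.weightedWelfare n / P.geomSum (n + 1)

/-- Weighted excess of the constant `g` over the welfare of a round. -/
noncomputable def weightedExcess (g : ℝ) (j : ℕ) : ℝ :=
  ∑ l ∈ Finset.range (j + 1), (P.lam / P.mu) ^ l * (g - P.meanRoundWelfare l)

theorem weightedExcess_eq (g : ℝ) (j : ℕ) :
    P.weightedExcess g j = g * P.geomSum (j + 1) - P.weightedWelfare j := by
  simp only [weightedExcess, geomSum, weightedWelfare, Finset.mul_sum, ← Finset.sum_sub_distrib]
  exact Finset.sum_congr rfl fun l _ => by ring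

theorem weightedExcess_stationaryWelfare (n : ℕ) :
    P.weightedExcess (P.stationaryWelfare n) n = 0 := by
  rw [weightedExcess_eq, stationaryWelfare, div_mul_cancel₀ _ (P.geomSum_succ_pos n).ne', sub_self]

/-- Relative value function: solution of the Poisson equation of the chain. -/
noncomputable def relativeValue (g : ℝ) (u : ℕ) : ℝ :=
  ∑ j ∈ Finset.range u, P.weightedExcess g j / (P.arrivalProb * (P.lam / P.mu) ^ j)

theorem relativeValue_succ (g : ℝ) (u : ℕ) : P.relativeValue g (u + 1) =
    P.relativeValue g u + P.weightedExcess g u / (P.arrivalProb * (P.lam / P.mu) ^ u) := by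
  unfold relativeValue
  rw [Finset.sum_range_succ]

theorem serviceProb_mul_load : P.serviceProb * (P.lam / P.mu) = P.arrivalProb := by
  have h2 := P.mu_pos
  unfold arrivalProb serviceProb
  field_simp

/-- The increments of `relativeValue`, weighted by `arrivalProb * ρ ^ u`, are the partial sums of
the weighted excess; by detailed balance their differences give the equation. The truncated `u - 1`
at `u = 0` is the fictitious service. The cap at `n` plays no role yet. -/
theorem relativeValue_poisson (g : ℝ) (u : ℕ) :
    P.arrivalProb * P.relativeValue g (u + 1) + P.serviceProb * P.relativeValue g (u - 1) =
      P.relativeValue g u + (g - P.meanRoundWelfare u) := by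
  have ha := P.arrivalProb_pos.ne'
  have hs := P.serviceProb_pos.ne'
  have h1 := P.arrivalProb_add_serviceProb
  have hρ := P.load_pos.ne'
  cases u with
  | zero =>
    simp only [relativeValue, weightedExcess]
    simp
    field_simp
  | succ m =>
    have hQ : P.weightedExcess g (m + 1) = P.weightedExcess g m +
        (P.lam / P.mu) ^ (m + 1) * (g - P.meanRoundWelfare (m + 1)) := by
      unfold weightedExcess
      rw [Finset.sum_range_succ]
    rw [relativeValue_succ P g (m + 1), Nat.add_sub_cancel, relativeValue_succ P g m, hQ]
    have hab := P.serviceProb_mul_load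
    set ρ := P.lam / P.mu
    set s := P.serviceProb
    rw [← hab] at h1 ⊢
    have hρm : ρ ^ m ≠ 0 := pow_ne_zero _ hρ
    have e1 : s * ρ * ((P.weightedExcess g m + ρ ^ (m + 1) * (g - P.meanRoundWelfare (m + 1))) /
        (s * ρ * ρ ^ (m + 1))) = P.weightedExcess g m / ρ ^ (m + 1) +
          (g - P.meanRoundWelfare (m + 1)) := by
      field_simp
    have e2 : s * (P.weightedExcess g m / (s * ρ * ρ ^ m)) =
        P.weightedExcess g m / ρ ^ (m + 1) := by
      field_simp
      ring
    generalize P.weightedExcess g m / (s * ρ * ρ ^ m) = y at e2 ⊢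
    generalize (P.weightedExcess g m + ρ ^ (m + 1) * (g - P.meanRoundWelfare (m + 1))) /
        (s * ρ * ρ ^ (m + 1)) = z at e1 ⊢
    linear_combination e1 - e2 + (P.relativeValue g m + y) * h1

theorem integral_roundWelfare (n k : ℕ) :
    ∫ ω, P.roundWelfare n ω k ∂P.eventsLaw =
      ∫ ω, P.meanRoundWelfare (eventChain (thresholdStep n) 0 ω k) ∂P.eventsLaw := by
  have h := P.integral_eventChain_event (thresholdStep n) 0 k fun u b =>
    (if b = false ∧ 0 < u then P.r else 0) - P.roundCost * u
  simp only [roundWelfare, thresholdQueue_eq_eventChain]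
  rw [h]
  refine integral_congr_ae (ae_of_all _ fun ω => ?_)
  have h1 := P.arrivalProb_add_serviceProb
  simp only [meanRoundWelfare, Bool.true_eq_false, false_and, if_false, true_and]
  linear_combination (-P.roundCost * (eventChain (thresholdStep n) 0 ω k : ℝ)) * h1

theorem integrable_roundWelfare (n k : ℕ) :
    Integrable (fun ω => P.roundWelfare n ω k) P.eventsLaw := by
  refine Integrable.of_bound (C := P.r + P.roundCost * n) ?_ (ae_of_all _ fun ω => ?_)
  · have h : Measurable fun ω => P.roundWelfare n ω k := by
      have := (measurable_of_countable fun p : ℕ × Bool =>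
        (if p.2 = false ∧ 0 < p.1 then P.r else 0) - P.roundCost * p.1).comp
        ((measurable_eventChain (thresholdStep n) 0 k).prodMk (measurable_pi_apply k))
      simpa only [roundWelfare, thresholdQueue_eq_eventChain, Function.comp_def] using this
    exact h.aestronglyMeasurable
  · have hq : (thresholdQueue n 0 ω k : ℝ) ≤ n := by
      rw [thresholdQueue_eq_eventChain]
      exact_mod_cast eventChain_thresholdStep_le n ω k
    have hr := P.r_pos
    have hc := P.roundCost_pos
    have h1 : P.roundCost * (thresholdQueue n 0 ω k : ℝ) ≤ P.roundCost * n :=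
      mul_le_mul_of_nonneg_left hq hc.le
    have h2 : 0 ≤ P.roundCost * (thresholdQueue n 0 ω k : ℝ) := by positivity
    rw [Real.norm_eq_abs, abs_le]
    unfold roundWelfare
    constructor <;> split_ifs <;> linarith

theorem integral_sum_roundWelfare (n K : ℕ) :
    ∫ ω, ∑ k ∈ Finset.range K, P.roundWelfare n ω k ∂P.eventsLaw =
      K * P.stationaryWelfare n -
        ∫ ω, P.relativeValue (P.stationaryWelfare n) (eventChain (thresholdStep n) 0 ω K)
          ∂P.eventsLaw := by
  set g := P.stationaryWelfare n
  rw [integral_finsetSum _ fun k _ => P.integrable_roundWelfare n k]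
  have h := P.integral_potential_eventChain (thresholdStep n) 0 (P.relativeValue g)
    (fun u => g - P.meanRoundWelfare u) (fun ω k => by
      have hle := eventChain_thresholdStep_le n ω k
      generalize eventChain (thresholdStep n) 0 ω k = u at hle
      rw [← P.relativeValue_poisson g u]
      simp only [thresholdStep, if_true, Bool.false_eq_true, if_false]
      rcases hle.lt_or_eq with hlt | rfl
      · rw [min_eq_left (by omega)]
      -- At the cap the total excess vanishes, so `relativeValue` agrees at `n` and `n + 1`: a
      -- blocked arrival satisfies the uncapped equation.
      · rw [min_eq_right (by omega), relativeValue_succ, P.weightedExcess_stationaryWelfare]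
        simp) K
  rw [h]
  simp_rw [integral_roundWelfare]
  have h2 : ∀ k, ∫ ω, (g - P.meanRoundWelfare (eventChain (thresholdStep n) 0 ω k)) ∂P.eventsLaw =
      g - ∫ ω, P.meanRoundWelfare (eventChain (thresholdStep n) 0 ω k) ∂P.eventsLaw := fun k => by
    rw [integral_sub (integrable_const _) (P.integrable_eventChain _ _ _ _)]
    simp
  simp_rw [h2]
  simp [relativeValue]

/-- The correction term of `integral_sum_roundWelfare` is bounded, because the chain stays in `{0,
…, n}`, and disappears after division by `K`. -/
theorem longRunWelfare_eq (n : ℕ) :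
    P.longRunWelfare n = (P.lam + P.mu) * P.stationaryWelfare n := by
  set g := P.stationaryWelfare n with hg
  have hpos := add_pos P.lam_pos P.mu_pos
  let I : ℕ → ℝ := fun K =>
    ∫ ω, P.relativeValue g (eventChain (thresholdStep n) 0 ω K) ∂P.eventsLaw
  obtain ⟨C, hC⟩ : ∃ C, ∀ u ≤ n, |P.relativeValue g u| ≤ C := by
    obtain ⟨C, hC⟩ := ((Finset.range (n + 1)).image fun u => |P.relativeValue g u|).bddAbove
    exact ⟨C, fun u hu => hC (by
      simp only [Finset.coe_image, Set.mem_image, Finset.coe_range, Set.mem_Iio]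
      exact ⟨u, by omega, rfl⟩)⟩
  have hI : ∀ K, |I K| ≤ C := fun K => by
    have := norm_integral_le_of_norm_le_const (μ := P.eventsLaw) (C := C)
      (f := fun ω => P.relativeValue g (eventChain (thresholdStep n) 0 ω K))
      (ae_of_all _ fun ω => hC _ (eventChain_thresholdStep_le n ω K))
    simpa using this
  have hlim : Tendsto (fun K : ℕ => I K / K) atTop (nhds 0) := by
    refine squeeze_zero_norm (a := fun K : ℕ => C / K) (fun K => ?_)
      (tendsto_const_div_atTop_nhds_zero_nat C)
    rw [norm_div, Real.norm_eq_abs, Real.norm_eq_abs, Nat.abs_cast]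
    exact div_le_div_of_nonneg_right (hI K) (Nat.cast_nonneg K)
  have htend : Tendsto (fun K => P.averageWelfare n K) atTop (nhds ((P.lam + P.mu) * g)) := by
    have h := (tendsto_const_nhds (x := (P.lam + P.mu) * g)).sub
      (hlim.const_mul (P.lam + P.mu))
    rw [mul_zero, sub_zero] at h
    refine h.congr' ?_
    filter_upwards [eventually_gt_atTop 0] with K hK
    have hK' : (K : ℝ) ≠ 0 := by exact_mod_cast hK.ne'
    rw [averageWelfare, integral_sum_roundWelfare]
    change _ = (K * g - I K) / _
    field_simp
  exact htend.liminf_eq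

/-- The sign of the left side decides whether threshold `m + 1` improves on `m`. Raising `m` by one
lowers it by `roundCost * geomSum (m + 2)`, which is the source of the form of `criticalReward`. -/
theorem marginalWelfare_eq (m : ℕ) :
    P.meanRoundWelfare (m + 1) * P.geomSum (m + 1) - P.weightedWelfare m =
      P.serviceProb * (P.r - P.criticalReward (m + 1)) := by
  have hsc := P.serviceProb_mul_criticalReward_one
  induction m with
  | zero =>
    simp only [weightedWelfare, meanRoundWelfare, geomSum]
    simp
    linear_combination hsc
  | succ m ih =>
    have hw : P.weightedWelfare (m + 1) = P.weightedWelfare m +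
        (P.lam / P.mu) ^ (m + 1) * P.meanRoundWelfare (m + 1) := by
      unfold weightedWelfare
      rw [Finset.sum_range_succ]
    have hf : P.meanRoundWelfare (m + 1 + 1) = P.meanRoundWelfare (m + 1) - P.roundCost := by
      simp [meanRoundWelfare]
      ring
    have h1 : P.criticalReward 1 = P.c / P.mu := by simp [criticalReward, geomSum]
    rw [h1] at hsc
    rw [hw, hf, P.criticalReward_succ (m + 1)]
    have hG := P.geomSum_succ' (m + 1)
    linear_combination ih + P.geomSum (m + 1 + 1) * hsc + P.meanRoundWelfare (m + 1) * hG

theorem IsSociallyOptimalThreshold.criticalReward_le {P : QueueParams} {N : ℕ}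
    (hN : P.IsSociallyOptimalThreshold N) : P.criticalReward N ≤ P.r := by
  cases N with
  | zero => simpa using P.r_pos.le
  | succ m =>
    have h := hN m
    rw [longRunWelfare_eq, longRunWelfare_eq] at h
    have h1 := le_of_mul_le_mul_left h (add_pos P.lam_pos P.mu_pos)
    unfold stationaryWelfare at h1
    rw [div_le_div_iff₀ (P.geomSum_succ_pos m) (P.geomSum_succ_pos (m + 1))] at h1
    have hw : P.weightedWelfare (m + 1) = P.weightedWelfare m +
        (P.lam / P.mu) ^ (m + 1) * P.meanRoundWelfare (m + 1) := by
      unfold weightedWelfare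
      rw [Finset.sum_range_succ]
    rw [hw, P.geomSum_succ' (m + 1)] at h1
    -- After cross-multiplication the common products cancel and leave the marginal welfare times `ρ
    -- ^ (m + 1)`.
    have h2 : 0 ≤ (P.lam / P.mu) ^ (m + 1) *
        (P.serviceProb * (P.r - P.criticalReward (m + 1))) := by
      rw [← marginalWelfare_eq]
      linarith
    have h3 := nonneg_of_mul_nonneg_right h2 (pow_pos P.load_pos _)
    have h4 := nonneg_of_mul_nonneg_right h3 P.serviceProb_pos
    linarith

end QueueParams

/-! ### Potentials along absorbed chains -/

/-- The step function leaves `0` and all states above `N` fixed. -/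
def AbsorbsOutside (N : ℕ) (step : ℕ → Bool → ℕ) : Prop :=
  ∀ u b, u = 0 ∨ N < u → step u b = u

/-- Number of rounds that the chain spends in `{1, …, N}`. -/
noncomputable def occupationTime (N : ℕ) (step : ℕ → Bool → ℕ) (a : ℕ) (ω : ℕ → Bool) : ENNReal :=
  ∑' k : ℕ, {ω | 1 ≤ eventChain step a ω k ∧ eventChain step a ω k ≤ N}.indicator 1 ω

theorem measurableSet_eventChain (step : ℕ → Bool → ℕ) (a k : ℕ) (S : Set ℕ) :
    MeasurableSet {ω | eventChain step a ω k ∈ S} :=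
  measurable_eventChain step a k (MeasurableSet.of_discrete (s := S))

theorem measurableSet_eventChain_active (N : ℕ) (step : ℕ → Bool → ℕ) (a k : ℕ) :
    MeasurableSet {ω | 1 ≤ eventChain step a ω k ∧ eventChain step a ω k ≤ N} :=
  measurableSet_eventChain step a k (Set.Icc 1 N)

theorem measurable_occupationTime (N : ℕ) (step : ℕ → Bool → ℕ) (a : ℕ) :
    Measurable (occupationTime N step a) := by
  refine Measurable.tsum fun k => ?_
  exact measurable_one.indicator (measurableSet_eventChain_active N step a k)

namespace QueueParams

variable (P : QueueParams)

theorem lintegral_occupationTime (N : ℕ) (step : ℕ → Bool → ℕ) (a : ℕ) :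
    ∫⁻ ω, occupationTime N step a ω ∂P.eventsLaw = ∑' k : ℕ,
      P.eventsLaw {ω | 1 ≤ eventChain step a ω k ∧ eventChain step a ω k ≤ N} := by
  unfold occupationTime
  rw [lintegral_tsum fun k =>
    (measurable_one.indicator (measurableSet_eventChain_active N step a k)).aemeasurable]
  exact tsum_congr fun k => lintegral_indicator_one (measurableSet_eventChain_active N step a k)

section Potential

variable {N a : ℕ} {step : ℕ → Bool → ℕ} {φ : ℕ → ℝ}

theorem integral_potential_absorbed (hstep : AbsorbsOutside N step)
    (hφ : ∀ u, 1 ≤ u → u ≤ N → P.arrivalProb * φ (step u true) +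
      P.serviceProb * φ (step u false) = φ u + P.roundCost) (K : ℕ) :
    ∫ ω, φ (eventChain step a ω K) ∂P.eventsLaw =
      φ a + P.roundCost * ∑ k ∈ Finset.range K,
        P.eventsLaw.real {ω | 1 ≤ eventChain step a ω k ∧ eventChain step a ω k ≤ N} := by
  rw [P.integral_potential_eventChain step a φ
    ((Set.Icc 1 N).indicator fun _ => P.roundCost), Finset.mul_sum]
  · congr 1
    refine Finset.sum_congr rfl fun k _ => ?_
    have h := integral_indicator_const (μ := P.eventsLaw) P.roundCost
      (measurableSet_eventChain_active N step a k)
    rw [smul_eq_mul, mul_comm] at h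
    rw [← h]
    rfl
  · intro ω k
    generalize eventChain step a ω k = u
    by_cases hu : u ∈ Set.Icc 1 N
    · rw [Set.indicator_of_mem hu]
      exact hφ u hu.1 hu.2
    · rw [Set.indicator_of_notMem hu, hstep u true, hstep u false]
      · linear_combination φ u * P.arrivalProb_add_serviceProb
      all_goals
        simp only [Set.mem_Icc] at hu
        omega

theorem integral_potential_le (hφ : ∀ u, φ u ≤ φ 0) (K : ℕ) :
    ∫ ω, φ (eventChain step a ω K) ∂P.eventsLaw ≤ φ 0 := by
  have := integral_mono (P.integrable_eventChain step a K φ) (integrable_const (φ 0))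
    fun ω => hφ (eventChain step a ω K)
  simpa using this

/-- A potential bounded above that gains `roundCost` in each active round allows only a finite
expected number of such rounds; almost sure absorption follows. -/
theorem summable_active (hstep : AbsorbsOutside N step)
    (hφ : ∀ u, 1 ≤ u → u ≤ N → P.arrivalProb * φ (step u true) +
      P.serviceProb * φ (step u false) = φ u + P.roundCost)
    (hle : ∀ u, φ u ≤ φ 0) :
    Summable fun k =>
      P.eventsLaw.real {ω | 1 ≤ eventChain step a ω k ∧ eventChain step a ω k ≤ N} := by
  refine summable_of_sum_range_le (c := (φ 0 - φ a) / P.roundCost)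
    (fun k => measureReal_nonneg) fun K => ?_
  rw [le_div_iff₀ P.roundCost_pos]
  have h1 := P.integral_potential_absorbed (a := a) hstep hφ K
  have h2 := P.integral_potential_le (step := step) (a := a) hle K
  linarith

theorem lintegral_occupationTime_eq_ofReal (hstep : AbsorbsOutside N step)
    (hφ : ∀ u, 1 ≤ u → u ≤ N → P.arrivalProb * φ (step u true) +
      P.serviceProb * φ (step u false) = φ u + P.roundCost)
    (hle : ∀ u, φ u ≤ φ 0) :
    ∫⁻ ω, occupationTime N step a ω ∂P.eventsLaw = ENNReal.ofReal (∑' k,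
      P.eventsLaw.real {ω | 1 ≤ eventChain step a ω k ∧ eventChain step a ω k ≤ N}) := by
  rw [lintegral_occupationTime, ENNReal.ofReal_tsum_of_nonneg (fun k => measureReal_nonneg)
    (P.summable_active hstep hφ hle)]
  exact tsum_congr fun k => by simp

/-- The probability of absorption at `0` pays for the initial potential and the waiting cost. -/
theorem potential_add_cost_le (hstep : AbsorbsOutside N step)
    (hφ : ∀ u, 1 ≤ u → u ≤ N → P.arrivalProb * φ (step u true) +
      P.serviceProb * φ (step u false) = φ u + P.roundCost)
    (h0 : 0 ≤ φ 0) (hle : ∀ u, φ u ≤ φ 0) (hN : ∀ u, N < u → φ u = 0) :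
    φ a + P.roundCost * ∑' k,
      P.eventsLaw.real {ω | 1 ≤ eventChain step a ω k ∧ eventChain step a ω k ≤ N} ≤
      φ 0 * P.eventsLaw.real {ω | ∃ k, eventChain step a ω k = 0} := by
  have hs := P.summable_active (a := a) hstep hφ hle
  have hlim1 := (hs.hasSum.tendsto_sum_nat.const_mul P.roundCost).const_add (φ a)
  -- The vanishing term accounts for the paths not yet absorbed at time `K`.
  have hlim2 := (hs.tendsto_atTop_zero.const_mul (φ 0)).const_add
    (φ 0 * P.eventsLaw.real {ω | ∃ k, eventChain step a ω k = 0})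
  rw [mul_zero, add_zero] at hlim2
  refine le_of_tendsto_of_tendsto' hlim1 hlim2 fun K => ?_
  rw [← P.integral_potential_absorbed hstep hφ K]
  have hm0 := measurableSet_eventChain step a K {0}
  have hmA := measurableSet_eventChain_active N step a K
  have hi0 : Integrable ({ω | eventChain step a ω K ∈ ({0} : Set ℕ)}.indicator
      fun _ => φ 0) P.eventsLaw := (integrable_const _).indicator hm0
  have hiA : Integrable ({ω | 1 ≤ eventChain step a ω K ∧ eventChain step a ω K ≤ N}.indicator
      fun _ => φ 0) P.eventsLaw := (integrable_const _).indicator hmA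
  calc ∫ ω, φ (eventChain step a ω K) ∂P.eventsLaw
      ≤ ∫ ω, ({ω | eventChain step a ω K ∈ ({0} : Set ℕ)}.indicator (fun _ => φ 0) ω +
          {ω | 1 ≤ eventChain step a ω K ∧ eventChain step a ω K ≤ N}.indicator
            (fun _ => φ 0) ω) ∂P.eventsLaw := by
        refine integral_mono (P.integrable_eventChain step a K φ) (hi0.add hiA) fun ω => ?_
        simp only [Set.indicator_apply, Set.mem_ofPred_eq, Set.mem_singleton_iff]
        have hu := hle (eventChain step a ω K)
        have hu' := hN (eventChain step a ω K)
        split_ifs with h1 h2 h2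
        · linarith
        · linarith
        · linarith
        · rw [hu' (by omega)]
          simp
    _ = φ 0 * P.eventsLaw.real {ω | eventChain step a ω K ∈ ({0} : Set ℕ)} + φ 0 *
          P.eventsLaw.real {ω | 1 ≤ eventChain step a ω K ∧ eventChain step a ω K ≤ N} := by
        rw [integral_add hi0 hiA, integral_indicator_const _ hm0, integral_indicator_const _ hmA]
        simp [mul_comm]
    _ ≤ _ := by
        have hsub : {ω | eventChain step a ω K ∈ ({0} : Set ℕ)} ⊆
            {ω | ∃ k, eventChain step a ω k = 0} := fun ω hω => ⟨K, hω⟩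
        have := mul_le_mul_of_nonneg_left (measureReal_mono (μ := P.eventsLaw) hsub) h0
        linarith

/-- The waiting cost until absorption is at least the growth of the potential. -/
theorem le_potential_add_cost (hstep : AbsorbsOutside N step)
    (hφ : ∀ u, 1 ≤ u → u ≤ N → P.arrivalProb * φ (step u true) +
      P.serviceProb * φ (step u false) = φ u + P.roundCost)
    (hle : ∀ u, φ u ≤ φ 0) (hnn : ∀ u, 0 ≤ φ u) :
    φ 0 * P.eventsLaw.real {ω | ∃ k, eventChain step a ω k = 0} ≤
      φ a + P.roundCost * ∑' k,
        P.eventsLaw.real {ω | 1 ≤ eventChain step a ω k ∧ eventChain step a ω k ≤ N} := by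
  have hs := P.summable_active (a := a) hstep hφ hle
  -- As `0` is absorbing, continuity from below gives the probability of ever reaching it.
  have hmono : Monotone fun K => {ω | eventChain step a ω K = 0} := by
    refine monotone_nat_of_le_succ fun K ω hω => ?_
    simp only [Set.mem_ofPred_eq] at hω ⊢
    simp only [eventChain]
    rw [hstep _ _ (Or.inl hω), hω]
  have hlim : Tendsto (fun K => φ 0 * P.eventsLaw.real {ω | eventChain step a ω K = 0}) atTop
      (nhds (φ 0 * P.eventsLaw.real {ω | ∃ k, eventChain step a ω k = 0})) := by
    have h := tendsto_measure_iUnion_atTop (μ := P.eventsLaw) hmono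
    have h' := (ENNReal.tendsto_toReal (measure_ne_top _ _)).comp h
    rw [← Set.ofPred_exists] at h'
    exact h'.const_mul (φ 0)
  refine le_of_tendsto' hlim fun K => ?_
  have hm0 := measurableSet_eventChain step a K {0}
  calc φ 0 * P.eventsLaw.real {ω | eventChain step a ω K = 0}
      = ∫ ω, {ω | eventChain step a ω K ∈ ({0} : Set ℕ)}.indicator (fun _ => φ 0) ω
          ∂P.eventsLaw := by
        rw [integral_indicator_const _ hm0]
        simp [mul_comm]
    _ ≤ ∫ ω, φ (eventChain step a ω K) ∂P.eventsLaw := by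
        refine integral_mono ((integrable_const _).indicator hm0)
          (P.integrable_eventChain step a K φ) fun ω => ?_
        simp only [Set.indicator_apply, Set.mem_ofPred_eq, Set.mem_singleton_iff]
        split_ifs with h
        · rw [h]
        · exact hnn _
    _ ≤ _ := by
        rw [P.integral_potential_absorbed hstep hφ K]
        have := hs.sum_le_tsum (Finset.range K) fun k _ => measureReal_nonneg
        have := mul_le_mul_of_nonneg_left this P.roundCost_pos.le
        linarith

end Potential

end QueueParams

/-! ### Blocks of the threshold chain and the sign of `D` -/

/-- One step of the chain `thresholdQueue N N`, stopped when it reaches `0` or `N`; the stopping at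
`N` is represented by the state `N + 1`. -/
def blockStep (N u : ℕ) (b : Bool) : ℕ :=
  if u = 0 ∨ N < u then u
  else if b = true then (if N ≤ u + 1 then N + 1 else u + 1) else u - 1

theorem absorbsOutside_blockStep (N : ℕ) : AbsorbsOutside N (blockStep N) :=
  fun _ _ h => if_pos h

/-- The block is not over after `k` rounds. -/
def BlockRunning (N : ℕ) (ω : ℕ → Bool) (k : ℕ) : Prop :=
  ∀ j, 1 ≤ j → j ≤ k → thresholdQueue N N ω j ≠ 0 ∧ thresholdQueue N N ω j ≠ N

theorem BlockRunning.mono {N : ℕ} {ω : ℕ → Bool} {k l : ℕ} (h : BlockRunning N ω l) (hkl : k ≤ l) :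
    BlockRunning N ω k :=
  fun j h1 h2 => h j h1 (h2.trans hkl)

theorem blockRunning_succ {N : ℕ} {ω : ℕ → Bool} {k : ℕ} : BlockRunning N ω (k + 1) ↔
    BlockRunning N ω k ∧ thresholdQueue N N ω (k + 1) ≠ 0 ∧ thresholdQueue N N ω (k + 1) ≠ N := by
  constructor
  · exact fun h => ⟨h.mono (Nat.le_succ k), h (k + 1) (by omega) le_rfl⟩
  · rintro ⟨h1, h2⟩ j hj hjk
    rcases Nat.lt_or_ge j (k + 1) with h | h
    · exact h1 j hj (by omega)
    · obtain rfl : j = k + 1 := by omega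
      exact h2

theorem thresholdQueue_le (N : ℕ) (ω : ℕ → Bool) (k : ℕ) : thresholdQueue N N ω k ≤ N := by
  induction k with
  | zero => exact le_rfl
  | succ k ih =>
    simp only [thresholdQueue]
    split_ifs <;> omega

/-- The stopped copy follows the threshold chain while the block runs and is frozen afterwards,
although the threshold chain itself moves on. -/
theorem eventChain_blockStep {N : ℕ} (hN : 1 ≤ N) (ω : ℕ → Bool) (k : ℕ) :
    (BlockRunning N ω k ∧ eventChain (blockStep N) N ω k = thresholdQueue N N ω k ∧
      1 ≤ thresholdQueue N N ω k) ∨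
    (¬ BlockRunning N ω k ∧
      (eventChain (blockStep N) N ω k = 0 ∨ N < eventChain (blockStep N) N ω k)) := by
  induction k with
  | zero => exact Or.inl ⟨fun j h1 h2 => by omega, rfl, hN⟩
  | succ k ih =>
    rcases ih with ⟨h1, h2, h3⟩ | ⟨h1, h2⟩
    · have hle := thresholdQueue_le N ω k
      have hle' := thresholdQueue_le N ω (k + 1)
      rw [blockRunning_succ]
      simp only [thresholdQueue] at hle'
      simp only [h1, true_and, eventChain, thresholdQueue, blockStep, h2]
      generalize thresholdQueue N N ω k = y at *
      cases ω k <;> simp <;> grind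
    · right
      refine ⟨fun h => h1 (h.mono (Nat.le_succ k)), ?_⟩
      simp only [eventChain]
      rwa [absorbsOutside_blockStep N _ _ h2]

theorem blockRunning_iff {N : ℕ} (hN : 1 ≤ N) (ω : ℕ → Bool) (k : ℕ) : BlockRunning N ω k ↔
    1 ≤ eventChain (blockStep N) N ω k ∧ eventChain (blockStep N) N ω k ≤ N := by
  have hle := thresholdQueue_le N ω k
  rcases eventChain_blockStep hN ω k with ⟨h1, h2, h3⟩ | ⟨h1, h2⟩
  · simp only [h1, true_iff]
    omega
  · simp only [h1, false_iff]
    omega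

open Classical in
theorem blockLength_eq_occupationTime {N : ℕ} (hN : 1 ≤ N) (ω : ℕ → Bool) :
    QueueParams.blockLength N ω = occupationTime N (blockStep N) N ω := by
  have hocc : occupationTime N (blockStep N) N ω =
      ∑' k : ℕ, if BlockRunning N ω k then (1 : ENNReal) else 0 := by
    refine tsum_congr fun k => ?_
    simp only [Set.indicator_apply, Set.mem_ofPred_eq, Pi.one_apply, blockRunning_iff hN]
  rw [hocc]
  unfold QueueParams.blockLength
  by_cases hex : ∃ k, 1 ≤ k ∧ (thresholdQueue N N ω k = 0 ∨ thresholdQueue N N ω k = N)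
  · have hm := Nat.find_spec hex
    have hmin := fun j => Nat.find_min hex (m := j)
    generalize Nat.find hex = m at hm hmin
    have hrun : ∀ k, BlockRunning N ω k ↔ k < m := by
      intro k
      constructor
      · intro h
        by_contra hk
        have := h m hm.1 (by omega)
        tauto
      · intro hk j h1 h2
        have := hmin j (by omega)
        tauto
    simp_rw [hrun]
    rw [tsum_eq_sum (s := Finset.range m) (by
      intro k hk
      simp only [Finset.mem_range] at hk
      simp [hk]), Finset.sum_congr rfl (g := fun _ => 1) (by
      intro k hk
      simp only [Finset.mem_range] at hk
      simp [hk])]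
    simp only [Finset.sum_const, Finset.card_range, nsmul_eq_mul, mul_one]
    refine le_antisymm (iInf₂_le m hm) (le_iInf₂ fun k hk => ?_)
    have : m ≤ k := by
      by_contra h
      exact hmin k (by omega) hk
    exact_mod_cast this
  · have hrun : ∀ k, BlockRunning N ω k := fun k j h1 h2 =>
      not_or.1 fun h => hex ⟨j, h1, h⟩
    simp only [hrun, if_true]
    rw [ENNReal.tsum_const_eq_top_of_ne_zero one_ne_zero, iInf_eq_top]
    exact fun k => iInf_eq_top.2 fun hk => (hex ⟨k, hk⟩).elim

theorem eventChain_blockStep_eq_zero {N : ℕ} (hN : 1 ≤ N) (ω : ℕ → Bool) {k : ℕ} (hk : 1 ≤ k)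
    (h0 : thresholdQueue N N ω k = 0)
    (hlt : ∀ j, 1 ≤ j → j < k → thresholdQueue N N ω j ≠ N) :
    ∃ m, eventChain (blockStep N) N ω m = 0 := by
  -- The given `k` need not be the first visit to `0`; only at the first one is the block known to
  -- be running just before.
  have hex : ∃ k, 1 ≤ k ∧ thresholdQueue N N ω k = 0 := ⟨k, hk, h0⟩
  have hm := Nat.find_spec hex
  have hmin := fun j => Nat.find_min hex (m := j)
  have hmk : Nat.find hex ≤ k := Nat.find_min' hex ⟨hk, h0⟩
  generalize Nat.find hex = m at hm hmin hmk
  obtain ⟨l, rfl⟩ : ∃ l, m = l + 1 := ⟨m - 1, by omega⟩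
  have hrun : BlockRunning N ω l := fun j h1 h2 =>
    ⟨fun h => hmin j (by omega) ⟨h1, h⟩, hlt j h1 (by omega)⟩
  refine ⟨l + 1, ?_⟩
  have hle := thresholdQueue_le N ω l
  have h2 := hm.2
  rcases eventChain_blockStep hN ω l with ⟨-, h3, h4⟩ | ⟨h3, -⟩
  · simp only [eventChain, blockStep, h3]
    simp only [thresholdQueue] at h2
    generalize thresholdQueue N N ω l = y at *
    cases hω : ω l
    · simp [hω] at h2 ⊢
      grind
    · simp [hω] at h2
      omega
  · exact absurd hrun h3

namespace QueueParams

theorem criticalReward_lt_of_D_pos (P : QueueParams) {N : ℕ} (hN : 1 ≤ N) (hD : 0 < P.D N) :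
    P.criticalReward N < P.r := by
  have hstep := absorbsOutside_blockStep N
  have hφ : ∀ u, 1 ≤ u → u ≤ N →
      P.arrivalProb * (fun u => P.criticalReward (N - u)) (blockStep N u true) +
      P.serviceProb * (fun u => P.criticalReward (N - u)) (blockStep N u false) =
      (fun u => P.criticalReward (N - u)) u + P.roundCost := by
    intro u h1 h2
    have hu : ¬ (u = 0 ∨ N < u) := by omega
    simp only [blockStep, hu, if_false, if_true, Bool.false_eq_true]
    rcases h2.lt_or_eq with hlt | rfl
    · obtain ⟨m, rfl⟩ : ∃ m, N = u + (m + 1) := ⟨N - u - 1, by omega⟩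
      have e1 : u + (m + 1) - (u - 1) = m + 2 := by omega
      have e2 : u + (m + 1) - u = m + 1 := by omega
      rw [e1, e2, ← P.criticalReward_drift m]
      congr 3
      -- With truncated subtraction the exit state `N + 1` also lies at distance `0`, so stopping at
      -- `N` does not change the potential.
      split_ifs <;> omega
    · have e1 : u - (u - 1) = 1 := by omega
      rw [e1, if_pos (by omega), P.serviceProb_mul_criticalReward_one]
      simp
  have hle : ∀ u, (fun u => P.criticalReward (N - u)) u ≤ (fun u => P.criticalReward (N - u)) 0 :=
    fun u => P.criticalReward_mono (by omega)
  have hnn : ∀ u, 0 ≤ (fun u => P.criticalReward (N - u)) u :=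
    fun u => P.criticalReward_nonneg _
  have h1 := P.le_potential_add_cost (a := N) hstep hφ hle hnn
  have h2 := P.lintegral_occupationTime_eq_ofReal (a := N) hstep hφ hle
  simp only [Nat.sub_zero, Nat.sub_self, criticalReward_zero, zero_add] at h1
  have hT : P.expectedBlockLength N = ∑' k, P.eventsLaw.real
      {ω | 1 ≤ eventChain (blockStep N) N ω k ∧ eventChain (blockStep N) N ω k ≤ N} := by
    unfold expectedBlockLength
    simp_rw [blockLength_eq_occupationTime hN]
    rw [h2, ENNReal.toReal_ofReal (tsum_nonneg fun k => measureReal_nonneg)]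
  rw [← hT] at h1
  have hθ : P.theta N ≤ P.eventsLaw.real {ω | ∃ k, eventChain (blockStep N) N ω k = 0} := by
    refine measureReal_mono ?_
    rintro ω ⟨k, hk, h0, hlt⟩
    exact eventChain_blockStep_eq_zero hN ω hk h0 hlt
  have hθ0 : 0 ≤ P.theta N := ENNReal.toReal_nonneg
  have h3 := mul_le_mul_of_nonneg_left hθ (P.criticalReward_nonneg N)
  unfold D at hD
  by_contra hr
  -- If `r ≤ criticalReward N`, the expected reward of a block would not exceed its cost.
  have h4 := mul_le_mul_of_nonneg_right (not_lt.1 hr) hθ0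
  linarith

end QueueParams

/-! ### The patient strategy and its payoff -/

/-- One step of the walk absorbed at `0` and above `N`. -/
def walkStep (N u : ℕ) (b : Bool) : ℕ :=
  if u = 0 ∨ N < u then u else if b = true then u + 1 else u - 1

theorem absorbsOutside_walkStep (N : ℕ) : AbsorbsOutside N (walkStep N) :=
  fun _ _ h => if_pos h

/-- Upper bound for the current position of a customer who started at position `i`: the walk that
counts the events. -/
def positionBound (N i : ℕ) (h : QueueHistory) : ℕ := h.foldr (fun p u => walkStep N u p.2) i

/-- The customer stays until the walk that bounds her position exceeds `N`. -/
def patientStrategy (N i : ℕ) : CustomerStrategy := fun h => decide (positionBound N i h ≤ N)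

namespace QueuingRegime

variable {X : Type*} (R : QueuingRegime X)

theorem card_filter_opponentPositions_lt (I : Finset ℕ) (x : X) {i : ℕ} (hi : 1 ≤ i) :
    ((R.opponentPositions I x i).filter (· < i)).card < i := by
  have hsub : (R.opponentPositions I x i).filter (· < i) ⊆ Finset.Ico 1 i := by
    intro j hj
    simp only [opponentPositions, Finset.mem_filter] at hj
    exact Finset.mem_Ico.2 ⟨hj.1.2.1, hj.2⟩
  have := Finset.card_le_card hsub
  rw [Nat.card_Ico] at this
  omega

/-- All that is needed from the regime: departures ahead only move her forward, an arrival costs at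
most one place, and a service serves her or gains one. -/
theorem afterStay_cases (x : X) {i : ℕ} (hi : 1 ≤ i) (h : QueueHistory) (I : Finset ℕ) (e : Bool) :
    (e = false ∧ R.afterStay x i h (R.opponentPositions I x i) e = .served) ∨
    ∃ x' i', R.afterStay x i h (R.opponentPositions I x i) e =
      .present x' i' ((R.opponentPositions I x i, e) :: h) ∧ 1 ≤ i' ∧
      i' ≤ if e = true then i + 1 else i - 1 := by
  have hlt := R.card_filter_opponentPositions_lt I x hi
  simp only [afterStay]
  generalize ((R.opponentPositions I x i).filter (· < i)).card = d at hlt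
  cases e with
  | true =>
    right
    simp only [if_true]
    refine ⟨_, _, rfl, ?_, ?_⟩ <;> split_ifs <;> omega
  | false =>
    simp only [Bool.false_eq_true, if_false, true_and]
    by_cases hj : i - d = 1
    · left
      rw [if_pos hj]
    · right
      rw [if_neg hj]
      exact ⟨_, _, rfl, by omega, by omega⟩

/-- Coupling invariant. The history records all events, so the strategy can compute the walk
exactly, and she gives up only once it has crossed `N`. -/
theorem play_patientStrategy (N : ℕ) (x : X) {i : ℕ} (hi : 1 ≤ i) (τ : OpponentStrategy)
    (ω : ℕ → Bool) (k : ℕ) :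
    R.play x i (patientStrategy N i) τ ω k = .served ∨
    (R.play x i (patientStrategy N i) τ ω k = .gone ∧ N < eventChain (walkStep N) i ω k) ∨
    ∃ x' i' h, R.play x i (patientStrategy N i) τ ω k = .present x' i' h ∧ 1 ≤ i' ∧
      i' ≤ eventChain (walkStep N) i ω k ∧
      positionBound N i h = eventChain (walkStep N) i ω k := by
  induction k with
  | zero => exact Or.inr (Or.inr ⟨x, i, [], rfl, hi, le_rfl, rfl⟩)
  | succ k ih =>
    rcases ih with h1 | ⟨h1, h2⟩ | ⟨x', i', h, h1, h2, h3, h4⟩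
    · left
      simp only [play, h1]
    · right
      left
      simp only [play, h1, eventChain, true_and]
      rwa [absorbsOutside_walkStep N _ _ (Or.inr h2)]
    · simp only [play, h1, eventChain]
      by_cases hle : eventChain (walkStep N) i ω k ≤ N
      · have hs : patientStrategy N i h = true := by simp [patientStrategy, h4, hle]
        rw [if_pos hs]
        rcases R.afterStay_cases x' h2 h (τ h) (ω k) with ⟨-, h5⟩ | ⟨x'', i'', h5, h6, h7⟩
        · exact Or.inl h5
        · refine Or.inr (Or.inr ⟨x'', i'', _, h5, h6, ?_, ?_⟩)
          · have hnot : ¬ (eventChain (walkStep N) i ω k = 0 ∨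
                N < eventChain (walkStep N) i ω k) := by omega
            refine h7.trans ?_
            have hw : walkStep N (eventChain (walkStep N) i ω k) (ω k) = if ω k = true then
                eventChain (walkStep N) i ω k + 1 else eventChain (walkStep N) i ω k - 1 :=
              if_neg hnot
            rw [hw]
            split_ifs <;> omega
          · simp only [positionBound, List.foldr_cons]
            simp only [positionBound] at h4
            rw [h4]
      · have hs : ¬ patientStrategy N i h = true := by simpa [patientStrategy, h4] using hle
        rw [if_neg hs]
        refine Or.inr (Or.inl ⟨rfl, ?_⟩)
        rw [absorbsOutside_walkStep N _ _ (Or.inr (not_le.1 hle))]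
        exact not_le.1 hle

theorem play_eq_served_of_eventChain_eq_zero {N : ℕ} (x : X) {i : ℕ} (hi : 1 ≤ i)
    (τ : OpponentStrategy) (ω : ℕ → Bool) {k : ℕ} (hk : eventChain (walkStep N) i ω k = 0) :
    R.play x i (patientStrategy N i) τ ω k = .served := by
  rcases R.play_patientStrategy N x hi τ ω k with h | ⟨-, h⟩ | ⟨_, _, _, -, h1, h2, -⟩
  · exact h
  · omega
  · omega

theorem active_of_staysInRound {N : ℕ} (x : X) {i : ℕ} (hi : 1 ≤ i)
    (τ : OpponentStrategy) (ω : ℕ → Bool) {k : ℕ}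
    (hk : R.StaysInRound x i (patientStrategy N i) τ ω k) :
    1 ≤ eventChain (walkStep N) i ω k ∧ eventChain (walkStep N) i ω k ≤ N := by
  obtain ⟨x', i', h, hp, hs⟩ := hk
  rcases R.play_patientStrategy N x hi τ ω k with h1 | ⟨h1, -⟩ | ⟨_, _, _, h1, h2, h3, h4⟩
  · rw [hp] at h1
    exact absurd h1 (by simp)
  · rw [hp] at h1
    exact absurd h1 (by simp)
  · rw [hp] at h1
    obtain ⟨rfl, rfl, rfl⟩ := CustomerStatus.present.inj h1
    simp only [patientStrategy, decide_eq_true_eq] at hs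
    omega

open Classical in
theorem roundsInSystem_le_occupationTime (N : ℕ) (x : X) {i : ℕ} (hi : 1 ≤ i)
    (τ : OpponentStrategy) (ω : ℕ → Bool) :
    R.roundsInSystem x i (patientStrategy N i) τ ω ≤ occupationTime N (walkStep N) i ω := by
  refine ENNReal.tsum_le_tsum fun k => ?_
  simp only [Set.indicator_apply, Set.mem_ofPred_eq, Pi.one_apply]
  split_ifs with h1 h2
  · exact le_rfl
  · exact absurd (R.active_of_staysInRound x hi τ ω h1) h2
  · exact zero_le
  · exact le_rfl

theorem payoff_eq_zero_of_renege (P : QueueParams) (x : X) (i : ℕ) {s : CustomerStrategy}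
    (hs : s [] = false) {Z : Type} [MeasurableSpace Z] (ν : Measure Z) (τ : Z → OpponentStrategy) :
    R.payoff P x i s ν τ = 0 := by
  have hgone : ∀ z ω k, R.play x i s (τ z) ω (k + 1) = .gone := by
    intro z ω k
    induction k with
    | zero => simp [play, hs]
    | succ k ih => simp only [play] at ih ⊢; rw [ih]
  have hnot : ∀ z ω k, ¬ R.StaysInRound x i s (τ z) ω k := by
    rintro z ω k ⟨x', i', h, h1, h2⟩
    cases k with
    | zero =>
      obtain ⟨-, -, rfl⟩ := CustomerStatus.present.inj h1
      simp [hs] at h2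
    | succ k => rw [hgone] at h1; cases h1
  have hserved : {z : Z × (ℕ → Bool) | ∃ k, R.play x i s (τ z.1) z.2 k = .served} = ∅ := by
    ext z
    simp only [Set.mem_ofPred_eq, Set.mem_empty_iff_false, iff_false]
    rintro ⟨k, hk⟩
    cases k with
    | zero => cases hk
    | succ k => rw [hgone] at hk; cases hk
  simp [payoff, hserved, roundsInSystem, hnot]

/-- The payoff of the patient strategy is at least that of the walk that bounds the position. -/
theorem le_payoff_patientStrategy (P : QueueParams) (N : ℕ) (x : X) {i : ℕ} (hi : 1 ≤ i) {Z : Type}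
    [MeasurableSpace Z] (ν : Measure Z) [IsProbabilityMeasure ν] (τ : Z → OpponentStrategy)
    {t : ℝ} (ht0 : 0 ≤ t)
    (ht : ∫⁻ ω, occupationTime N (walkStep N) i ω ∂P.eventsLaw = ENNReal.ofReal t) :
    ((P.r * P.eventsLaw.real {ω | ∃ k, eventChain (walkStep N) i ω k = 0} -
      P.roundCost * t : ℝ) : EReal) ≤ R.payoff P x i (patientStrategy N i) ν τ := by
  have hmp : MeasurePreserving Prod.snd (ν.prod P.eventsLaw) P.eventsLaw := measurePreserving_snd
  have hm : MeasurableSet {ω | ∃ k, eventChain (walkStep N) i ω k = 0} := by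
    rw [Set.ofPred_exists]
    exact MeasurableSet.iUnion fun k => measurableSet_eventChain (walkStep N) i k {0}
  have h1 : P.eventsLaw {ω | ∃ k, eventChain (walkStep N) i ω k = 0} ≤
      (ν.prod P.eventsLaw)
        {z | ∃ k, R.play x i (patientStrategy N i) (τ z.1) z.2 k = .served} := by
    rw [← hmp.measure_preimage hm.nullMeasurableSet]
    -- Monotonicity alone is used, so the event of being served need not be measurable.
    refine measure_mono ?_
    rintro z ⟨k, hk⟩
    exact ⟨k, R.play_eq_served_of_eventChain_eq_zero x hi (τ z.1) z.2 hk⟩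
  have h2 : ∫⁻ z, R.roundsInSystem x i (patientStrategy N i) (τ z.1) z.2 ∂(ν.prod P.eventsLaw) ≤
      ENNReal.ofReal t := by
    rw [← ht, ← hmp.lintegral_comp (measurable_occupationTime N (walkStep N) i)]
    exact lintegral_mono fun z => R.roundsInSystem_le_occupationTime N x hi (τ z.1) z.2
  have e1 : ((P.r * P.eventsLaw.real {ω | ∃ k, eventChain (walkStep N) i ω k = 0} : ℝ) : EReal) =
      ((ENNReal.ofReal P.r *
        P.eventsLaw {ω | ∃ k, eventChain (walkStep N) i ω k = 0} : ENNReal) : EReal) := by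
    rw [← ofReal_measureReal, ← ENNReal.ofReal_mul P.r_pos.le, EReal.coe_ennreal_ofReal,
      max_eq_left (mul_nonneg P.r_pos.le measureReal_nonneg)]
  have e2 : ((P.roundCost * t : ℝ) : EReal) =
      ((ENNReal.ofReal P.roundCost * ENNReal.ofReal t : ENNReal) : EReal) := by
    rw [← ENNReal.ofReal_mul P.roundCost_pos.le, EReal.coe_ennreal_ofReal,
      max_eq_left (mul_nonneg P.roundCost_pos.le ht0)]
  rw [EReal.coe_sub, e1, e2]
  exact EReal.sub_le_sub (EReal.coe_ennreal_le_coe_ennreal_iff.2 (by gcongr))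
    (EReal.coe_ennreal_le_coe_ennreal_iff.2 (by gcongr))

/-- At most `N` positions away from service, the patient strategy earns at least the surplus of the
reward over its critical value, up to a positive factor. -/
theorem surplus_le_payoff_patientStrategy (P : QueueParams) {N : ℕ}
    (hr : P.criticalReward N ≤ P.r) (x : X) {i : ℕ} (hi : 1 ≤ i) (hiN : i ≤ N) {Z : Type}
    [MeasurableSpace Z] (ν : Measure Z) [IsProbabilityMeasure ν] (τ : Z → OpponentStrategy) :
    (((P.r - P.criticalReward N) / P.geomSum (N + 1) : ℝ) : EReal) ≤
      R.payoff P x i (patientStrategy N i) ν τ := by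
  -- The coefficient of the harmonic part that makes `φ 0 = r`.
  obtain ⟨e, he⟩ : ∃ e, e = (P.r - P.criticalReward N) / P.geomSum (N + 1) := ⟨_, rfl⟩
  have hG := P.geomSum_succ_pos N
  have he0 : 0 ≤ e := he ▸ div_nonneg (sub_nonneg.2 hr) hG.le
  -- The offsets differ on purpose: the cost part already vanishes at `N`, the harmonic part only at
  -- the barrier `N + 1`, which leaves `φ N = e`.
  obtain ⟨φ, hφd⟩ : ∃ φ : ℕ → ℝ, ∀ u, φ u =
      P.criticalReward (N - u) + e * P.geomSum (N + 1 - u) := ⟨_, fun _ => rfl⟩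
  have hφ0 : φ 0 = P.r := by
    rw [hφd, he, Nat.sub_zero, Nat.sub_zero, div_mul_cancel₀ _ hG.ne']
    ring
  have hstep := absorbsOutside_walkStep N
  have hanti : ∀ u v, u ≤ v → φ v ≤ φ u := by
    intro u v huv
    rw [hφd, hφd]
    exact add_le_add (P.criticalReward_mono (by omega))
      (mul_le_mul_of_nonneg_left (P.geomSum_mono (by omega)) he0)
  have hle : ∀ u, φ u ≤ φ 0 := fun u => hanti 0 u (Nat.zero_le u)
  have hN : ∀ u, N < u → φ u = 0 := by
    intro u hu
    rw [hφd, Nat.sub_eq_zero_of_le hu.le, Nat.sub_eq_zero_of_le (by omega : N + 1 ≤ u)]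
    simp
  have hφ : ∀ u, 1 ≤ u → u ≤ N → P.arrivalProb * φ (walkStep N u true) +
      P.serviceProb * φ (walkStep N u false) = φ u + P.roundCost := by
    intro u h1 h2
    have hu : ¬ (u = 0 ∨ N < u) := by omega
    simp only [walkStep, hu, if_false, if_true, Bool.false_eq_true, hφd]
    have hharm := P.geomSum_harmonic (N - u)
    have e3 : N + 1 - (u + 1) = N - u := by omega
    have e4 : N + 1 - (u - 1) = N - u + 2 := by omega
    have e5 : N + 1 - u = N - u + 1 := by omega
    have hcrit : P.arrivalProb * P.criticalReward (N - (u + 1)) +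
        P.serviceProb * P.criticalReward (N - (u - 1)) =
        P.criticalReward (N - u) + P.roundCost := by
      rcases h2.lt_or_eq with hlt | rfl
      · obtain ⟨m, rfl⟩ : ∃ m, N = u + (m + 1) := ⟨N - u - 1, by omega⟩
        have e1 : u + (m + 1) - (u - 1) = m + 2 := by omega
        have e2 : u + (m + 1) - u = m + 1 := by omega
        have e0 : u + (m + 1) - (u + 1) = m := by omega
        rw [e0, e1, e2, P.criticalReward_drift m]
      · have e1 : u - (u - 1) = 1 := by omega
        have e0 : u - (u + 1) = 0 := by omega
        rw [e0, e1, P.serviceProb_mul_criticalReward_one]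
        simp
    rw [e3, e4, e5]
    linear_combination hcrit + e * hharm
  have hmain := P.potential_add_cost_le (a := i) hstep hφ (hφ0 ▸ P.r_pos.le) hle hN
  have hT := P.lintegral_occupationTime_eq_ofReal (a := i) hstep hφ hle
  refine le_trans ?_ (R.le_payoff_patientStrategy P N x hi ν τ
    (tsum_nonneg fun k => measureReal_nonneg) hT)
  rw [hφ0] at hmain
  have hφi : e ≤ φ i := by
    refine le_trans (le_of_eq ?_) (hanti i N hiN)
    rw [hφd, Nat.sub_self, Nat.add_sub_cancel_left]
    simp [QueueParams.geomSum]
  rw [← he]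
  exact EReal.coe_le_coe_iff.2 (by linarith)

end QueuingRegime

theorem mainTheorem2 {X : Type*} (R : QueuingRegime X) (P : QueueParams) (N : ℕ)
    (hN : P.IsSociallyOptimalThreshold N) (x : X) (i : ℕ) (hi : 1 ≤ i) (hix : i ≤ R.size x)
    (hiN : i ≤ N) :
    R.StayingWeaklyDominant P x i ∧ (0 < P.D N → R.StayingStrictlyDominant P x i) := by
  have hr := hN.criticalReward_le
  have hs : patientStrategy N i [] = true := decide_eq_true hiN
  refine ⟨⟨patientStrategy N i, hs, fun s' hs' Z _ ν _ τ _ => ?_⟩,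
    fun hD => ⟨patientStrategy N i, hs, fun s' hs' Z _ ν _ τ _ => ?_⟩⟩
  · rw [R.payoff_eq_zero_of_renege P x i hs' ν τ]
    refine le_trans ?_ (R.surplus_le_payoff_patientStrategy P hr x hi hiN ν τ)
    exact EReal.coe_nonneg.2 (div_nonneg (sub_nonneg.2 hr) (P.geomSum_succ_pos N).le)
  · rw [R.payoff_eq_zero_of_renege P x i hs' ν τ]
    refine lt_of_lt_of_le ?_ (R.surplus_le_payoff_patientStrategy P hr x hi hiN ν τ)
    have hlt := P.criticalReward_lt_of_D_pos (hi.trans hiN) hD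
    exact EReal.coe_pos.2 (div_pos (sub_pos.2 hlt) (P.geomSum_succ_pos N))
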